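/- Let $k$ be a field. As usual, to avoid size problems, profinite sets and $k$-algebras are taken to be small with respect to a fixed strongly inaccessible cardinal (equivalently, a universe) for which $k$ is small. All algebras are commutative and unital. A \emph{condensed set} is a sheaf of sets $X:\mathrm{ProFin}^{\mathrm{op}}\to\mathrm{Set}$ for the topology of finite jointly surjective families; $k$ is viewed as the discrete condensed set $S\mapsto \mathcal C(S,k)$ of continuous (i.e. locally constant) functions, and $\mathrm{Hom}_{\mathrm{Cond}}(X,k)$ is a $k$-algebra under pointwise operations. An \emph{fpqc sheaf over $k$} is a functor $\mathcal X:\mathrm{CAlg}_k\to\mathrm{Set}$ that is a sheaf for the topology generated by the finite families $\{A\to B_i\}$ with $A\to\prod_i B_i$ faithfully flat; its algebra of global functions is $$\Gamma(\mathcal X,\mathcal O_{\mathcal X})=\lim_{A\in \mathrm{CAlg}_k,\ x\in\mathcal X(A)} A,$$ so that $\varphi\in\Gamma(\mathcal X,\mathcal O_{\mathcal X})$ assigns to every $x\in\mathcal X(A)$ an element $\varphi_A(x)\in A$, compatibly with homomorphisms of $k$-algebras. \emph{Stone $k$-algebras} are the $k$-algebras generated under filtered colimits by the algebras $k^n$,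 $n\ge 0$. The \emph{pearl} $A^\circ\subseteq A$ of a $k$-algebra $A$ is its largest Stone subalgebra (generated by the images of all homomorphisms from Stone algebras to $A$); by Stone duality it corresponds to the profinite set $\mathrm{Hom}_{\mathrm{CAlg}_k}(A^\circ,k)$, topologized by pointwise convergence with $k$ discrete. The \emph{pétra space} $X^{\mathrm{p\acute{e}t}}_k$ of a condensed set $X$ is the fpqc sheafification of the functor $A\mapsto X(\mathrm{Hom}_{\mathrm{CAlg}_k}(A^\circ,k))$; write $[y]\in X^{\mathrm{p\acute{e}t}}_k(A)$ for the point given by $y\in X(\mathrm{Hom}_{\mathrm{CAlg}_k}(A^\circ,k))$. \textbf{Proposition (Global functions).} Let $X$ be a condensed set and $\mathcal X=X^{\mathrm{p\acute{e}t}}_k$ its pétra space over $k$. There is a canonical isomorphism of $k$-algebras $$e:\Gamma(\mathcal X,\mathcal O_{\mathcal X})\;\xrightarrow{\ \sim\ }\;\mathrm{Hom}_{\mathrm{Cond}}(X,k).$$ Here canonical means that $e$ is compatible with evaluation at points: for every $\varphi\in\Gamma(\mathcal X,\mathcal O_{\mathcal X})$, every $k$-algebra $A$ and every $y\in X(\mathrm{Hom}_{\mathrm{CAlg}_k}(A^\circ,k))$,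 the element $\varphi_A([y])$ lies in $A^\circ$, and $$\chi\big(\varphi_A([y])\big)=e(\varphi)(y)(\chi)\qquad\text{for all }\chi\in\mathrm{Hom}_{\mathrm{CAlg}_k}(A^\circ,k),$$ where $e(\varphi)(y)\in\mathcal C(\mathrm{Hom}_{\mathrm{CAlg}_k}(A^\circ,k),k)$ is the image of $y$ under $e(\varphi)$. -/

import Mathlib

open CategoryTheory Opposite

universe u

namespace Petra

noncomputable section

/-! ### Condensed sets -/

/-- Condensed sets: sheaves of sets on profinite sets for the topology of finite jointly surjective
families. -/
abbrev CondSet : Type (u + 2) :=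
  Sheaf (coherentTopology Profinite.{u}) (Type (u + 1))

/-- A set `T`, viewed as a discrete condensed set `S ↦ C(S, T)`. -/
def discreteCond (T : Type u) : CondSet.{u} :=
  TopCat.toSheafCompHausLike.{u + 1, u} (fun Y => TotallyDisconnectedSpace Y)
    (TopCat.discrete.obj (ULift.{u + 1} T))
    (fun _ _ _ => ((Profinite.effectiveEpi_tfae _).out 0 2).mp)

/-- The value at `s : S` of a section over `S` of the discrete condensed set `T`. -/
def discreteCond.eval {T : Type u} {S : Profinite.{u}} (g : (discreteCond T).obj.obj (op S))
    (s : S) : T :=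
  ULift.down ((show C(S, TopCat.discrete.obj (ULift.{u + 1} T)) from g) s)

section CondHom

variable (k : Type u) [Field k] (X : CondSet.{u})

/-- Natural families of locally constant functions `S → k`, indexed by the points `x ∈ X(S)`,
with pointwise operations. -/
def condFunctions :
    Subalgebra k (∀ S : Profinite.{u}, X.obj.obj (op S) → S → k) where
  carrier := {F | (∀ S x, IsLocallyConstant (F S x)) ∧
    ∀ (S T : Profinite.{u}) (f : S ⟶ T) (x : X.obj.obj (op T)) (s : S),
      F S (X.obj.map f.op x) s = F T x (f s)}
  add_mem' := by
    rintro F G ⟨hF, hF'⟩ ⟨hG, hG'⟩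
    refine ⟨fun S x => (hF S x).add (hG S x), fun S T f x s => ?_⟩
    simp [hF', hG']
  mul_mem' := by
    rintro F G ⟨hF, hF'⟩ ⟨hG, hG'⟩
    refine ⟨fun S x => (hF S x).mul (hG S x), fun S T f x s => ?_⟩
    simp [hF', hG']
  algebraMap_mem' r := ⟨fun S x => IsLocallyConstant.const r, fun S T f x s => rfl⟩

variable {k X} in
/-- Maps of condensed sets `X ⟶ k` are the same as natural families of locally constant
functions. -/
def condHomEquiv : (X ⟶ discreteCond k) ≃ condFunctions k X where
  toFun φ := ⟨fun S x s => discreteCond.eval (φ.hom.app (op S) x) s, by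
    refine ⟨fun S x => ?_, fun S T f x s => ?_⟩
    · let g : C(S, TopCat.discrete.obj (ULift.{u + 1} k)) := φ.hom.app (op S) x
      exact ((IsLocallyConstant.iff_continuous g).2 g.continuous).comp ULift.down
    · exact congrArg (discreteCond.eval · s) (NatTrans.naturality_apply φ.hom f.op x)⟩
  invFun F := ⟨{
    app S := ↾fun x => (show C(S.unop, TopCat.discrete.obj (ULift.{u + 1} k)) from
      ⟨fun s => ULift.up (F.1 S.unop x s), continuous_def.2 fun U _ => (F.2.1 S.unop x).comp ULift.up U⟩)
    naturality S T f := by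
      ext x
      refine ContinuousMap.ext fun s => ?_
      exact congrArg ULift.up (F.2.2 T.unop S.unop f.unop x s) }⟩
  left_inv _ := rfl
  right_inv _ := rfl

/-- The pointwise ring structure on `Hom_Cond(X, k)`. -/
instance : CommRing (X ⟶ discreteCond k) := fast_instance% condHomEquiv.commRing

/-- The pointwise `k`-algebra structure on `Hom_Cond(X, k)`. -/
instance : Algebra k (X ⟶ discreteCond k) := condHomEquiv.algebra k

end CondHom

/-! ### Stone algebras, the pearl and the Stone dual -/

section Stone

variable (k : Type u) [Field k]

/-- Stone `k`-algebras: the full subcategory of `k`-algebras generated under (small) filtered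
colimits by the algebras `k ^ n`. -/
def IsStone : ObjectProperty (CommAlgCat.{u} k) :=
  ObjectProperty.colimitsClosure
    (fun A => ∃ n : ℕ, Nonempty (A ≅ CommAlgCat.of k (Fin n → k)))
    (fun J : {J : Cat.{u, u} // IsFiltered J} => J.1)

/-- The pearl of a `k`-algebra `A`: the subalgebra generated by the images of all Stone algebras
mapping to `A`. As `k` is a field, it is the largest Stone subalgebra of `A`, and its inclusion is
terminal among homomorphisms from Stone `k`-algebras to `A`. -/
def pearl (A : CommAlgCat.{u} k) : Subalgebra k A :=
  sSup {B | ∃ C : CommAlgCat.{u} k, IsStone k C ∧ ∃ g : C →ₐ[k] A, g.range = B}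

variable {k}

lemma pearl_le_comap {A B : CommAlgCat.{u} k} (f : A →ₐ[k] B) :
    pearl k A ≤ (pearl k B).comap f := by
  refine sSup_le ?_
  rintro _ ⟨C, hC, g, rfl⟩
  rw [← Subalgebra.map_le, ← AlgHom.range_comp]
  exact le_sSup ⟨C, hC, f.comp g, rfl⟩

/-- Functoriality of the pearl. -/
def pearlMap {A B : CommAlgCat.{u} k} (f : A →ₐ[k] B) : pearl k A →ₐ[k] pearl k B :=
  (f.comp (pearl k A).val).codRestrict (pearl k B) fun a => pearl_le_comap f a.2

/-- The elements of an algebra taking only finitely many values at its `k`-points. -/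
def finVal (k : Type u) [Field k] (A : Type u) [CommRing A] [Algebra k A] : Subalgebra k A where
  carrier := {a | (Set.range fun χ : A →ₐ[k] k => χ a).Finite}
  add_mem' {a b} ha hb := by
    refine (ha.add hb).subset ?_
    rintro _ ⟨χ, rfl⟩
    exact ⟨_, ⟨χ, rfl⟩, _, ⟨χ, rfl⟩, (map_add χ a b).symm⟩
  mul_mem' {a b} ha hb := by
    refine (ha.mul hb).subset ?_
    rintro _ ⟨χ, rfl⟩
    exact ⟨_, ⟨χ, rfl⟩, _, ⟨χ, rfl⟩, (map_mul χ a b).symm⟩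
  algebraMap_mem' r := by
    refine (Set.finite_singleton r).subset ?_
    rintro _ ⟨χ, rfl⟩
    simp

lemma map_finVal_le {A B : Type u} [CommRing A] [Algebra k A] [CommRing B] [Algebra k B]
    (g : A →ₐ[k] B) : (finVal k A).map g ≤ finVal k B := by
  rintro _ ⟨a, ha, rfl⟩
  refine Set.Finite.subset ha ?_
  rintro _ ⟨χ, rfl⟩
  exact ⟨χ.comp g, rfl⟩

lemma finVal_eq_top {A : CommAlgCat.{u} k} (hA : IsStone k A) : finVal k A = ⊤ := by
  induction hA with
  | of_mem A h =>
    obtain ⟨n, ⟨e⟩⟩ := h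
    refine eq_top_iff.2 fun a _ => ?_
    refine (Set.finite_range (e.hom a)).subset ?_
    rintro _ ⟨χ, rfl⟩
    have h0 : ∏ i, (a - algebraMap k A (e.hom a i)) = 0 := by
      have hinj : Function.Injective e.hom := fun x y h => by
        simpa using congrArg e.inv h
      refine hinj ?_
      rw [map_prod, map_zero]
      funext j
      rw [Finset.prod_apply]
      refine Finset.prod_eq_zero (Finset.mem_univ j) ?_
      rw [map_sub, AlgHomClass.commutes]
      simp
    have h1 := congrArg χ h0
    rw [map_prod, map_zero, Finset.prod_eq_zero_iff] at h1
    obtain ⟨i, -, hi⟩ := h1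
    exact ⟨i, (sub_eq_zero.1 (by simpa using hi)).symm⟩
  | of_isoClosure e _ ih =>
    rename_i A B _
    refine eq_top_iff.2 fun b _ => ?_
    refine map_finVal_le e.hom.hom ⟨e.inv b, ?_, by simp⟩
    rw [ih]; trivial
  | of_colimitPresentation pres _ ih =>
    rename_i A J _
    have hmem : ∀ j (x : pres.diag.obj j), pres.ι.app j x ∈ finVal k A := fun j x =>
      map_finVal_le (pres.ι.app j).hom ⟨x, by rw [ih j]; trivial, rfl⟩
    let c : Limits.Cocone pres.diag :=
      { pt := CommAlgCat.of k (finVal k A)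
        ι := { app j := CommAlgCat.ofHom ((pres.ι.app j).hom.codRestrict (finVal k A) (hmem j))
               naturality i j f := by
                ext x
                exact Subtype.ext (congrArg (fun φ => φ x) (pres.ι.naturality f)) } }
    have h : pres.isColimit.desc c ≫ CommAlgCat.ofHom (finVal k A).val = 𝟙 A := by
      refine pres.isColimit.hom_ext fun j => ?_
      rw [← Category.assoc, pres.isColimit.fac]
      rfl
    refine eq_top_iff.2 fun a _ => ?_
    have h' := congrArg (fun φ => φ a) h
    have h'' : ((pres.isColimit.desc c a : finVal k A) : A) = a := h'
    rw [← h'']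
    exact Subtype.property _

lemma finVal_pearl (A : CommAlgCat.{u} k) : finVal k (pearl k A) = ⊤ := by
  have h : pearl k A ≤ (finVal k (pearl k A)).map (pearl k A).val := by
    refine sSup_le ?_
    rintro _ ⟨C, hC, g, rfl⟩
    rintro _ ⟨c, rfl⟩
    have hg : ∀ c, g c ∈ pearl k A := fun c =>
      (le_sSup (a := g.range) ⟨C, hC, g, rfl⟩ : g.range ≤ pearl k A) ⟨c, rfl⟩
    refine ⟨g.codRestrict _ hg c, map_finVal_le (g.codRestrict _ hg) ⟨c, ?_, rfl⟩, rfl⟩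
    rw [finVal_eq_top hC]; trivial
  refine eq_top_iff.2 fun a _ => ?_
  obtain ⟨b, hb, hba⟩ := h a.2
  exact (Subtype.ext hba : b = a) ▸ hb

variable (k) in
/-- The `k`-points of the pearl of `A`. -/
def PearlPoints (A : CommAlgCat.{u} k) : Type u := pearl k A →ₐ[k] k

/-- The topology of pointwise convergence, with `k` discrete. -/
instance (A : CommAlgCat.{u} k) : TopologicalSpace (PearlPoints k A) :=
  .induced (fun χ (a : pearl k A) => (show pearl k A →ₐ[k] k from χ) a)
    (@Pi.topologicalSpace _ _ fun _ => ⊥)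

lemma PearlPoints.isClosedEmbedding (A : CommAlgCat.{u} k) :
    letI : TopologicalSpace k := ⊥
    Topology.IsClosedEmbedding
      fun (χ : PearlPoints k A) (a : pearl k A) => (show pearl k A →ₐ[k] k from χ) a := by
  let _ : TopologicalSpace k := ⊥
  have : DiscreteTopology k := ⟨rfl⟩
  refine ⟨⟨⟨rfl⟩, fun χ ψ h => AlgHom.ext fun a => congrFun h a⟩, ?_⟩
  have : (Set.range fun (χ : PearlPoints k A) (a : pearl k A) =>
      (show pearl k A →ₐ[k] k from χ) a) =
      {f | (∀ a b, f (a + b) = f a + f b) ∧ (∀ a b, f (a * b) = f a * f b) ∧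
        ∀ r, f (algebraMap k _ r) = r} := by
    ext f
    constructor
    · rintro ⟨χ, rfl⟩
      exact ⟨fun a b => map_add (show pearl k A →ₐ[k] k from χ) a b,
        fun a b => map_mul (show pearl k A →ₐ[k] k from χ) a b,
        fun r => AlgHom.commutes (show pearl k A →ₐ[k] k from χ) r⟩
    · rintro ⟨h1, h2, h3⟩
      refine ⟨(show pearl k A →ₐ[k] k from
        { toFun := f
          map_one' := by simpa using h3 1
          map_mul' := h2
          map_zero' := by simpa using h3 0
          map_add' := h1
          commutes' := h3 }), rfl⟩
  rw [this]
  simp only [Set.ofPred_and, Set.ofPred_forall]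
  refine .inter ?_ (.inter ?_ ?_)
  · exact isClosed_iInter fun a => isClosed_iInter fun b =>
      isClosed_eq (continuous_apply _) ((continuous_apply a).add (continuous_apply b))
  · exact isClosed_iInter fun a => isClosed_iInter fun b =>
      isClosed_eq (continuous_apply _) ((continuous_apply a).mul (continuous_apply b))
  · exact isClosed_iInter fun r => isClosed_eq (continuous_apply _) continuous_const

instance (A : CommAlgCat.{u} k) : T2Space (PearlPoints k A) := by
  let _ : TopologicalSpace k := ⊥
  have : DiscreteTopology k := ⟨rfl⟩
  exact (PearlPoints.isClosedEmbedding A).isEmbedding.t2Space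

instance (A : CommAlgCat.{u} k) : TotallyDisconnectedSpace (PearlPoints k A) := by
  let _ : TopologicalSpace k := ⊥
  have : DiscreteTopology k := ⟨rfl⟩
  exact (PearlPoints.isClosedEmbedding A).isEmbedding.isTotallyDisconnected_range.1
    (isTotallyDisconnected_of_totallyDisconnectedSpace _)

instance (A : CommAlgCat.{u} k) : CompactSpace (PearlPoints k A) := by
  let _ : TopologicalSpace k := ⊥
  have : DiscreteTopology k := ⟨rfl⟩
  have hK : IsCompact (Set.univ.pi fun a : pearl k A =>
      Set.range fun χ : pearl k A →ₐ[k] k => χ a) := by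
    refine isCompact_univ_pi fun a => Set.Finite.isCompact ?_
    have : a ∈ finVal k (pearl k A) := by rw [finVal_pearl]; trivial
    exact this
  have h := (PearlPoints.isClosedEmbedding A).isCompact_preimage hK
  refine isCompact_univ_iff.1 (h.of_isClosed_subset isClosed_univ ?_)
  exact fun χ _ a _ => ⟨χ, rfl⟩

variable (k) in
/-- The functor sending a `k`-algebra `A` to the profinite set corresponding to its pearl under
Stone duality, i.e. the profinite set `Hom(pearl A, k)`. -/
def stoneDual : (CommAlgCat.{u} k)ᵒᵖ ⥤ Profinite.{u} where
  obj A := Profinite.of (PearlPoints k A.unop)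
  map {A B} f := CompHausLike.ofHom _
    { toFun := fun χ => AlgHom.comp (show pearl k A.unop →ₐ[k] k from χ) (pearlMap f.unop.hom)
      continuous_toFun := by
        let _ : TopologicalSpace k := ⊥
        refine continuous_induced_rng.2 (continuous_pi fun a => ?_)
        exact (continuous_apply (pearlMap f.unop.hom a)).comp continuous_induced_dom }

end Stone

/-! ### Fpqc sheaves and the petra space -/

section Fpqc

variable (k : Type u) [Field k]

/-- The coverings of the affine `k`-scheme `Spec A`: finite families `Spec (B i) ⟶ Spec A` for which
`A → ∏ i, B i` is faithfully flat. -/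
def fpqcPrecoverage : Precoverage (CommAlgCat.{u} k)ᵒᵖ where
  coverings A := {R | ∃ (n : ℕ) (B : Fin n → CommAlgCat.{u} k) (f : ∀ i, A.unop ⟶ B i),
    (RingHom.pi fun i => (f i).hom.toRingHom).FaithfullyFlat ∧
      R = Presieve.ofArrows (fun i => op (B i)) (fun i => (f i).op)}

/-- The fpqc topology on affine `k`-schemes. -/
def fpqc : GrothendieckTopology (CommAlgCat.{u} k)ᵒᵖ := (fpqcPrecoverage k).toGrothendieck

/-- Fpqc sheaves of sets over `k`, as functors on `k`-algebras. -/
abbrev FpqcSheaf : Type (u + 2) := Sheaf (fpqc k) (Type (u + 1))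

variable {k}

/-- The set `𝒳(A)` of `A`-points of an fpqc sheaf. -/
abbrev FpqcSheaf.Points (𝒳 : FpqcSheaf k) (A : CommAlgCat.{u} k) : Type (u + 1) :=
  𝒳.obj.obj (op (op A))

/-- The map `𝒳(A) → 𝒳(B)` induced by a `k`-algebra homomorphism `A → B`. -/
abbrev FpqcSheaf.mapPoints (𝒳 : FpqcSheaf k) {A B : CommAlgCat.{u} k} (f : A ⟶ B) :
    𝒳.Points A → 𝒳.Points B :=
  𝒳.obj.map f.op.op

/-- The `k`-algebra `Γ(𝒳, 𝒪)`, that is the limit of the algebras `A` over all points `x ∈ 𝒳(A)`: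
a global function has a value in `A` at each `A`-point, compatibly with base change. -/
def globalSections (𝒳 : FpqcSheaf k) :
    Subalgebra k (∀ A : CommAlgCat.{u} k, 𝒳.Points A → A) where
  carrier := {φ | ∀ (A B : CommAlgCat.{u} k) (f : A ⟶ B) (x : 𝒳.Points A),
    φ B (𝒳.mapPoints f x) = f (φ A x)}
  add_mem' {φ ψ} hφ hψ A B f x := by simp [hφ A B f x, hψ A B f x]
  mul_mem' {φ ψ} hφ hψ A B f x := by simp [hφ A B f x, hψ A B f x]
  algebraMap_mem' r A B f x := (AlgHomClass.commutes f.hom r).symm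

variable (k) in
/-- The functor sending a condensed set `X` to its petra space over `k`, the fpqc sheafification
of the presheaf `A ↦ X(Hom(pearl A, k))`. -/
def petra : CondSet.{u} ⥤ FpqcSheaf k :=
  sheafToPresheaf _ _ ⋙ (Functor.whiskeringLeft _ _ _).obj (stoneDual k).op ⋙
    presheafToSheaf (fpqc k) (Type (u + 1))

/-- The canonical map `X(Hom(pearl A, k)) → 𝒳(A)` to the points of the petra space. -/
def petraPoint (X : CondSet.{u}) (A : CommAlgCat.{u} k)
    (y : X.obj.obj (op ((stoneDual k).obj (op A)))) : ((petra k).obj X).Points A :=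
  (toSheafify (fpqc k) ((stoneDual k).op ⋙ X.obj)).app (op (op A)) y

end Fpqc

end

end Petra

/-! Stone duality together with faithfully flat descent. The pearl of `A` is the subalgebra
generated by the idempotents of `A` (`pearl_eq_idemSub`). Its elements are detected by its
`k`-points (`eq_zero_of_forall_algHom`), and every locally constant function on those points comes
from it (`PearlPoints.exists_eval_eq`). Hence `dualHom` identifies the locally constant functions on
the Stone dual of `A` with the pearl, naturally in `A`. Conversely, a profinite set `S` is the Stone
dual of `locConst k S` (`evalIso`).

A global function therefore yields a function on `X`: its values at the points over the algebras
`locConst k S`. By naturality along `dualHom`, these determine its value at every `[y]`, and this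
value lies in the pearl (`apply_petraPoint`). Since `A ↦ A` is an fpqc sheaf
(`isSheaf_structurePresheaf`), a map from the sheafification to it is the same as a map from the
presheaf. So the values at the points `[y]` determine the global function, and every function on `X`
arises by applying `dualHom`. -/

namespace Petra

noncomputable section

/-! ### The pearl as the subalgebra generated by idempotents -/

section Idempotents

variable {k : Type u} [Field k]

/-- The subalgebra generated by the idempotents. -/
def idemSub (k : Type u) [Field k] (A : Type u) [CommRing A] [Algebra k A] : Subalgebra k A :=
  Algebra.adjoin k {e | IsIdempotentElem e}

lemma map_idemSub_le {A B : Type u} [CommRing A] [Algebra k A] [CommRing B] [Algebra k B]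
    (g : A →ₐ[k] B) : (idemSub k A).map g ≤ idemSub k B := by
  rw [idemSub, AlgHom.map_adjoin]
  refine Algebra.adjoin_mono ?_
  rintro _ ⟨e, he, rfl⟩
  exact IsIdempotentElem.map he g

lemma map_mem_idemSub {A B : Type u} [CommRing A] [Algebra k A] [CommRing B] [Algebra k B]
    (g : A →ₐ[k] B) (h : idemSub k A = ⊤) (a : A) : g a ∈ idemSub k B :=
  map_idemSub_le g ⟨a, by rw [h]; trivial, rfl⟩

lemma idemSub_pi (n : ℕ) : idemSub k (Fin n → k) = ⊤ := by
  refine eq_top_iff.2 fun a _ => ?_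
  have : a = ∑ i, a i • Pi.single i (1 : k) := by
    ext j
    simp [Finset.sum_apply, Pi.single_apply]
  rw [this]
  refine sum_mem fun i _ => Subalgebra.smul_mem _ (Algebra.subset_adjoin ?_) _
  simp [IsIdempotentElem, ← Pi.single_mul_left]

/-- The property passes to colimits: the cocone legs factor through `idemSub k A`, and the induced
map `A → idemSub k A` is a section of the inclusion, which is thus surjective. -/
lemma idemSub_eq_top {A : CommAlgCat.{u} k} (hA : IsStone k A) : idemSub k A = ⊤ := by
  induction hA with
  | of_mem A h =>
    obtain ⟨n, ⟨e⟩⟩ := h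
    refine eq_top_iff.2 fun a _ => ?_
    have := map_mem_idemSub e.inv.hom (idemSub_pi n) (e.hom a)
    rwa [show e.inv.hom (e.hom a) = a from CommAlgCat.inv_hom_apply e a] at this
  | of_isoClosure e _ ih =>
    refine eq_top_iff.2 fun b _ => ?_
    have := map_mem_idemSub e.hom.hom ih (e.inv b)
    rwa [show e.hom.hom (e.inv b) = b from CommAlgCat.hom_inv_apply e b] at this
  | of_colimitPresentation pres _ ih =>
    rename_i A J _
    let c : Limits.Cocone pres.diag :=
      { pt := CommAlgCat.of k (idemSub k A)
        ι := { app j := CommAlgCat.ofHom ((pres.ι.app j).hom.codRestrict (idemSub k A)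
                  (map_mem_idemSub _ (ih j)))
               naturality i j f := by
                ext x
                exact Subtype.ext (congrArg (fun φ => φ x) (pres.ι.naturality f)) } }
    have h : pres.isColimit.desc c ≫ CommAlgCat.ofHom (idemSub k A).val = 𝟙 A := by
      refine pres.isColimit.hom_ext fun j => ?_
      rw [← Category.assoc, pres.isColimit.fac]
      rfl
    refine eq_top_iff.2 fun a _ => ?_
    have h' : ((pres.isColimit.desc c a : idemSub k A) : A) = a := congrArg (fun φ => φ a) h
    rw [← h']
    exact Subtype.property _

/-- The homomorphism `k ^ 2 → A` defined by an idempotent. -/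
def algHomOfIdem {A : Type u} [CommRing A] [Algebra k A] {e : A} (he : IsIdempotentElem e) :
    (Fin 2 → k) →ₐ[k] A :=
  AlgHom.ofLinearMap
    ((LinearMap.toSpanSingleton k A e).comp (LinearMap.proj 0) +
      (LinearMap.toSpanSingleton k A (1 - e)).comp (LinearMap.proj 1))
    (by simp)
    (fun x y => by
      have he' : e * e = e := he
      simp only [LinearMap.add_apply, LinearMap.comp_apply, LinearMap.proj_apply, Pi.mul_apply,
        LinearMap.toSpanSingleton_apply, Algebra.smul_def, map_mul]
      -- The two sides differ by `-(x 0 - x 1) * (y 0 - y 1)` times `e * e - e`.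
      linear_combination (-(algebraMap k A (x 0) * algebraMap k A (y 0))
        + algebraMap k A (x 0) * algebraMap k A (y 1) + algebraMap k A (x 1) * algebraMap k A (y 0)
        - algebraMap k A (x 1) * algebraMap k A (y 1)) * he')

lemma idem_mem_pearl (A : CommAlgCat.{u} k) {e : A} (he : IsIdempotentElem e) :
    e ∈ pearl k A := by
  have hC : IsStone k (CommAlgCat.of k (Fin 2 → k)) := .of_mem _ ⟨2, ⟨Iso.refl _⟩⟩
  have hle : (algHomOfIdem he).range ≤ pearl k A := le_sSup ⟨_, hC, algHomOfIdem he, rfl⟩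
  exact hle ⟨Pi.single 0 1, by simp [algHomOfIdem]⟩

lemma pearl_eq_idemSub (A : CommAlgCat.{u} k) : pearl k A = idemSub k A := by
  refine le_antisymm (sSup_le ?_) (Algebra.adjoin_le fun e he => idem_mem_pearl A he)
  rintro _ ⟨C, hC, g, rfl⟩ _ ⟨c, rfl⟩
  exact map_mem_idemSub g (idemSub_eq_top hC) c

/-- The idempotents of `A` lie in the pearl, so they are idempotents of the pearl itself and still
generate it. -/
lemma idemSub_pearl (A : CommAlgCat.{u} k) : idemSub k (pearl k A) = ⊤ := by
  have h : pearl k A ≤ (idemSub k (pearl k A)).map (pearl k A).val := by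
    conv_lhs => rw [pearl_eq_idemSub]
    refine Algebra.adjoin_le fun e he => ?_
    exact ⟨⟨e, idem_mem_pearl A he⟩, Algebra.subset_adjoin (Subtype.ext he), rfl⟩
  refine eq_top_iff.2 fun a _ => ?_
  obtain ⟨b, hb, hba⟩ := h a.2
  exact (Subtype.ext hba : b = a) ▸ hb

/-- An algebra generated by idempotents has enough `k`-points to detect zero. -/
lemma eq_zero_of_forall_algHom {R : Type u} [CommRing R] [Algebra k R] (hR : idemSub k R = ⊤)
    (a : R) (ha : ∀ χ : R →ₐ[k] k, χ a = 0) : a = 0 := by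
  refine eq_zero_of_localization a fun J hJ => ?_
  let L := Localization.AtPrime J
  -- In a local ring every idempotent is `0` or `1`, so an algebra generated by idempotents has
  -- image `k` in each of its localizations at a maximal ideal. Each such localization thus provides
  -- a `k`-point `χ`, and `χ a = 0` forces `a` to vanish there.
  have hmem : ∀ x : R, algebraMap R L x ∈ (⊥ : Subalgebra k L) := by
    intro x
    have hx : x ∈ idemSub k R := by rw [hR]; trivial
    refine (Algebra.adjoin_le (S := (⊥ : Subalgebra k L).comap (IsScalarTower.toAlgHom k R L))
      ?_ : idemSub k R ≤ _) hx
    intro e he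
    have he' : algebraMap R L e * algebraMap R L e = algebraMap R L e := by
      rw [← map_mul, show e * e = e from he]
    change algebraMap R L e ∈ (⊥ : Subalgebra k L)
    rcases IsLocalRing.isUnit_or_isUnit_one_sub_self (algebraMap R L e) with h | h
    · rw [h.mul_eq_left.1 he']
      exact one_mem _
    · have : (1 - algebraMap R L e) * algebraMap R L e = 0 := by linear_combination -he'
      rw [h.mul_right_eq_zero.1 this]
      exact zero_mem _
  let χ : R →ₐ[k] k := (Algebra.botEquivOfInjective (algebraMap k L).injective).toAlgHom.comp
    ((IsScalarTower.toAlgHom k R L).codRestrict ⊥ hmem)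
  have h0 : (⟨algebraMap R L a, hmem a⟩ : (⊥ : Subalgebra k L)) = 0 :=
    (Algebra.botEquivOfInjective (algebraMap k L).injective).injective
      ((ha χ).trans (map_zero _).symm)
  exact congrArg Subtype.val h0

lemma pearl_ext (A : CommAlgCat.{u} k) {a b : pearl k A}
    (h : ∀ χ : pearl k A →ₐ[k] k, χ a = χ b) : a = b :=
  sub_eq_zero.1 (eq_zero_of_forall_algHom (idemSub_pearl A) _ fun χ => by
    rw [map_sub, h, sub_self])

end Idempotents

/-! ### Stone duality: functions on the points of the pearl -/

section Points

variable {k : Type u} [Field k] (A : CommAlgCat.{u} k)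

/-- A point of the pearl, as a homomorphism. -/
def PearlPoints.toAlgHom {A : CommAlgCat.{u} k} (χ : PearlPoints k A) : pearl k A →ₐ[k] k := χ

/-- The function on the `k`-points of the pearl defined by an element of the pearl. -/
def PearlPoints.eval (a : pearl k A) (χ : PearlPoints k A) : k :=
  χ.toAlgHom a

variable {A}

lemma PearlPoints.isLocallyConstant_eval (a : pearl k A) :
    IsLocallyConstant (PearlPoints.eval A a) := by
  let _ : TopologicalSpace k := ⊥
  have : DiscreteTopology k := ⟨rfl⟩
  refine (IsLocallyConstant.iff_continuous _).2 ?_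
  exact (continuous_apply a).comp (PearlPoints.isClosedEmbedding A).continuous

lemma PearlPoints.eval_mul (a b : pearl k A) (χ : PearlPoints k A) :
    eval A (a * b) χ = eval A a χ * eval A b χ :=
  map_mul χ.toAlgHom a b

lemma PearlPoints.eval_one_sub (a : pearl k A) (χ : PearlPoints k A) :
    eval A (1 - a) χ = 1 - eval A a χ := by
  have := map_sub χ.toAlgHom 1 a
  rwa [map_one] at this

/-- Idempotents generate the pearl, so some idempotent separates the two points. It takes only the
values `0` and `1`; replace it by its complement if needed. -/
lemma PearlPoints.exists_eval_eq_one_zero {χ ψ : PearlPoints k A} (h : χ ≠ ψ) :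
    ∃ e : pearl k A, eval A e χ = 1 ∧ eval A e ψ = 0 := by
  have key : ∃ e : pearl k A, IsIdempotentElem e ∧ eval A e χ ≠ eval A e ψ := by
    by_contra! hc
    exact h (AlgHom.ext_of_adjoin_eq_top (idemSub_pearl A) fun e he => hc e he)
  obtain ⟨e, he, hne⟩ := key
  have h01 : ∀ χ : PearlPoints k A, eval A e χ = 0 ∨ eval A e χ = 1 := fun χ => by
    rw [← IsIdempotentElem.iff_eq_zero_or_one]
    exact he.map χ.toAlgHom
  rcases h01 χ with h1 | h1 <;> rcases h01 ψ with h2 | h2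
  · exact absurd (h1.trans h2.symm) hne
  · exact ⟨1 - e, by rw [eval_one_sub, h1, sub_zero], by rw [eval_one_sub, h2, sub_self]⟩
  · exact ⟨e, h1, h2⟩
  · exact absurd (h1.trans h2.symm) hne

/-- Separating elements work near each point of `K`; by compactness, finitely many suffice, and
their product vanishes on `K`. -/
lemma PearlPoints.exists_eval_eq_one_of_isCompact {K : Set (PearlPoints k A)} (hK : IsCompact K)
    {χ : PearlPoints k A} (hχ : χ ∉ K) :
    ∃ e : pearl k A, eval A e χ = 1 ∧ ∀ ψ ∈ K, eval A e ψ = 0 := by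
  have hloc : ∀ ψ ∈ K, ∃ t ∈ nhdsWithin ψ K,
      ∃ e : pearl k A, eval A e χ = 1 ∧ ∀ ψ ∈ t, eval A e ψ = 0 := fun ψ hψ => by
    obtain ⟨e, h1, h2⟩ := exists_eval_eq_one_zero (A := A) (fun h => hχ (h ▸ hψ) : χ ≠ ψ)
    exact ⟨_, mem_nhdsWithin_of_mem_nhds (((isLocallyConstant_eval e).isOpen_fiber 0).mem_nhds h2),
      e, h1, fun _ h => h⟩
  refine hK.induction_on ⟨1, ?_, by simp⟩ ?_ ?_ hloc
  · exact map_one χ.toAlgHom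
  · rintro s t hst ⟨e, h1, h2⟩
    exact ⟨e, h1, fun ψ hψ => h2 ψ (hst hψ)⟩
  · rintro s t ⟨e, h1, h2⟩ ⟨e', h1', h2'⟩
    refine ⟨e * e', by rw [eval_mul, h1, h1', mul_one], ?_⟩
    rintro ψ (hψ | hψ)
    · rw [eval_mul, h2 ψ hψ, zero_mul]
    · rw [eval_mul, h2' ψ hψ, mul_zero]

/-- Compactness again, now of `U`: local solutions `e`, `e'` combine as `1 - (1 - e) * (1 - e')`,
which is `1` where either is and `0` where both are. -/
lemma PearlPoints.exists_eval_eq_indicator {U : Set (PearlPoints k A)} (hU : IsClopen U) :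
    ∃ e : pearl k A, (∀ χ ∈ U, eval A e χ = 1) ∧ ∀ χ ∉ U, eval A e χ = 0 := by
  have hloc : ∀ ψ ∈ U, ∃ t ∈ nhdsWithin ψ U,
      ∃ e : pearl k A, (∀ χ ∈ t, eval A e χ = 1) ∧ ∀ χ ∉ U, eval A e χ = 0 := fun ψ hψ => by
    obtain ⟨e, h1, h2⟩ := exists_eval_eq_one_of_isCompact hU.compl.isClosed.isCompact
      (not_not.2 hψ : ψ ∉ Uᶜ)
    exact ⟨_, mem_nhdsWithin_of_mem_nhds (((isLocallyConstant_eval e).isOpen_fiber 1).mem_nhds h1),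
      e, fun _ h => h, h2⟩
  refine hU.isClosed.isCompact.induction_on
    (p := fun t => ∃ e : pearl k A, (∀ χ ∈ t, eval A e χ = 1) ∧ ∀ χ ∉ U, eval A e χ = 0) ⟨0, by simp, ?_⟩ ?_ ?_ hloc
  · exact fun χ _ => map_zero χ.toAlgHom
  · rintro s t hst ⟨e, h1, h2⟩
    exact ⟨e, fun ψ hψ => h1 ψ (hst hψ), h2⟩
  · rintro s t ⟨e, h1, h2⟩ ⟨e', h1', h2'⟩
    refine ⟨1 - (1 - e) * (1 - e'), ?_, fun χ hχ => ?_⟩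
    · rintro ψ (hψ | hψ) <;> simp only [eval_one_sub, eval_mul]
      · rw [h1 ψ hψ]; ring
      · rw [h1' ψ hψ]; ring
    · simp only [eval_one_sub, eval_mul]
      rw [h2 χ hχ, h2' χ hχ]; ring

/-- Stone duality: locally constant functions on the `k`-points of the pearl are elements of the
pearl. -/
lemma PearlPoints.exists_eval_eq {f : PearlPoints k A → k} (hf : IsLocallyConstant f) :
    ∃ a : pearl k A, ∀ χ, eval A a χ = f χ := by
  classical
  choose e h1 h0 using fun c => exists_eval_eq_indicator (hf.isClopen_fiber c)
  -- By compactness `f` has finitely many values, so it is a finite combination of indicators of its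
  -- clopen fibres.
  have hfin : (Set.range f).Finite := hf.range_finite
  refine ⟨∑ c ∈ hfin.toFinset, c • e c, fun χ => ?_⟩
  have : eval A (∑ c ∈ hfin.toFinset, c • e c) χ = ∑ c ∈ hfin.toFinset, c * eval A (e c) χ := by
    simp only [eval]
    rw [map_sum]
    simp only [map_smul, smul_eq_mul]
  rw [this, Finset.sum_eq_single (f χ)]
  · rw [h1 (f χ) χ rfl, mul_one]
  · intro c _ hc
    rw [h0 c χ fun h => hc h.symm, mul_zero]
  · intro h
    exact absurd (hfin.mem_toFinset.2 ⟨χ, rfl⟩) h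

end Points

/-! ### Faithfully flat descent: `A ↦ A` is an fpqc sheaf -/

section Descent

open TensorProduct

variable (k : Type u) [Field k]

/-- The structure presheaf `A ↦ A` on affine `k`-schemes. -/
def structurePresheaf : (CommAlgCat.{u} k)ᵒᵖᵒᵖ ⥤ Type (u + 1) :=
  unopUnop _ ⋙ forget (CommAlgCat.{u} k) ⋙ uliftFunctor.{u + 1, u}

variable {k}

/-- Faithfully flat descent of elements along the base change of a finite family. -/
lemma exists_of_faithfullyFlat_pi {A A' : Type u} [CommRing A] [CommRing A'] [Algebra A A']
    {n : ℕ} (B : Fin n → Type u) [∀ i, CommRing (B i)] [∀ i, Algebra A (B i)]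
    [Module.FaithfullyFlat A (∀ i, B i)] (c : ∀ i, A' ⊗[A] B i)
    (hc : ∀ i j, (c i ⊗ₜ[A'] (1 : A' ⊗[A] B j)) = (1 : A' ⊗[A] B i) ⊗ₜ[A'] c j) :
    ∃ a : A', ∀ i, algebraMap A' (A' ⊗[A] B i) a = c i := by
  classical
  -- Extension by zero `ι` and projection `π` play the role of a decomposition of the base-changed
  -- product into its factors, reducing the family to a single faithfully flat algebra.
  let ι : ∀ i, A' ⊗[A] B i →ₗ[A'] A' ⊗[A] (∀ i, B i) := fun i =>
    (LinearMap.single A B i).baseChange A'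
  let π : ∀ i, A' ⊗[A] (∀ i, B i) →ₐ[A'] A' ⊗[A] B i := fun i =>
    Algebra.TensorProduct.map (AlgHom.id A' A') (Pi.evalAlgHom A B i)
  have hπι : ∀ i j x, π i (ι j x) = if h : j = i then h ▸ x else 0 := by
    intro i j x
    induction x with
    | zero => split_ifs with h <;> [subst h; skip] <;> simp
    | add x y hx hy => rw [map_add, map_add, hx, hy]; split_ifs with h <;> [subst h; skip] <;> simp
    | tmul a b =>
      simp only [ι, π, LinearMap.baseChange_tmul, Algebra.TensorProduct.map_tmul]
      split_ifs with h
      · subst h; simp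
      · simp [Pi.single_eq_of_ne' h]
  have h1 : (1 : A' ⊗[A] (∀ i, B i)) = ∑ i, ι i 1 := by
    simp only [Algebra.TensorProduct.one_def, ι, LinearMap.baseChange_tmul, ← tmul_sum]
    congr 1
    ext i
    simp
  have heff := Algebra.IsEffective.of_faithfullyFlat A' (A' ⊗[A] (∀ i, B i))
  -- Writing `1` as `∑ i, ι i 1` splits the descent condition into its `(i, j)` components, each the
  -- image of `hc i j` under `ι i ⊗ ι j`.
  obtain ⟨a, ha⟩ := (heff (∑ i, ι i (c i))).1 (by
    rw [Algebra.TensorProduct.includeLeftSubRight_apply, sub_eq_zero, h1]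
    simp only [sum_tmul, tmul_sum]
    refine Finset.sum_congr rfl fun j _ => Finset.sum_congr rfl fun i _ => ?_
    simpa using congrArg (TensorProduct.map (ι i) (ι j)) (hc i j))
  refine ⟨a, fun i => ?_⟩
  have := congrArg (π i) ha
  rw [map_sum, Algebra.linearMap_apply, AlgHom.commutes] at this
  rw [this]
  simp only [hπι]
  simp

lemma eq_of_faithfullyFlat_pi {A A' : Type u} [CommRing A] [CommRing A'] [Algebra A A']
    {n : ℕ} (B : Fin n → Type u) [∀ i, CommRing (B i)] [∀ i, Algebra A (B i)]
    [Module.FaithfullyFlat A (∀ i, B i)] {a a' : A'}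
    (h : ∀ i, algebraMap A' (A' ⊗[A] B i) a = algebraMap A' (A' ⊗[A] B i) a') : a = a' := by
  classical
  let ι : ∀ i, A' ⊗[A] B i →ₗ[A'] A' ⊗[A] (∀ i, B i) := fun i =>
    (LinearMap.single A B i).baseChange A'
  have h1 : (1 : A' ⊗[A] (∀ i, B i)) = ∑ i, ι i 1 := by
    simp only [Algebra.TensorProduct.one_def, ι, LinearMap.baseChange_tmul, ← tmul_sum]
    congr 1
    ext i
    simp
  have key : ∀ a : A', algebraMap A' (A' ⊗[A] (∀ i, B i)) a =
      ∑ i, ι i (algebraMap A' (A' ⊗[A] B i) a) := fun a => by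
    simp only [Algebra.algebraMap_eq_smul_one, map_smul, ← Finset.smul_sum, ← h1]
  refine FaithfulSMul.algebraMap_injective A' (A' ⊗[A] (∀ i, B i)) ?_
  rw [key, key]
  simp only [h]

/-- The base change of a faithfully flat family, and descent of elements along it. -/
lemma exists_baseChange {A A' : CommAlgCat.{u} k} (f : A ⟶ A') {n : ℕ}
    (B : Fin n → CommAlgCat.{u} k) (b : ∀ i, A ⟶ B i)
    (hb : (RingHom.pi fun i => (b i).hom.toRingHom).FaithfullyFlat) :
    ∃ (C : Fin n → CommAlgCat.{u} k) (g : ∀ i, A' ⟶ C i) (h : ∀ i, B i ⟶ C i),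
      (∀ i, f ≫ g i = b i ≫ h i) ∧
      (∀ (i) (D : CommAlgCat.{u} k) (u : A' ⟶ D) (v : B i ⟶ D), f ≫ u = b i ≫ v →
        ∃ l : C i ⟶ D, g i ≫ l = u) ∧
      (∀ a a' : A', (∀ i, g i a = g i a') → a = a') ∧
      ∀ c : ∀ i, C i, (∀ (i j) (D : CommAlgCat.{u} k) (u : C i ⟶ D) (v : C j ⟶ D),
        g i ≫ u = g j ≫ v → u (c i) = v (c j)) → ∃ a : A', ∀ i, g i a = c i := by
  let _ : Algebra A A' := f.hom.toRingHom.toAlgebra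
  let _ : ∀ i, Algebra A (B i) := fun i => (b i).hom.toRingHom.toAlgebra
  have : IsScalarTower k A A' := .of_algebraMap_eq fun r => (f.hom.commutes r).symm
  have : ∀ i, IsScalarTower k A (B i) := fun i =>
    .of_algebraMap_eq fun r => ((b i).hom.commutes r).symm
  have : Module.FaithfullyFlat A (∀ i, B i) := by
    rw [← RingHom.faithfullyFlat_algebraMap_iff]
    exact hb
  refine ⟨fun i => CommAlgCat.of k (A' ⊗[A] B i),
    fun i => CommAlgCat.ofHom (IsScalarTower.toAlgHom k A' (A' ⊗[A] B i)),
    fun i => CommAlgCat.ofHom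
      ((Algebra.TensorProduct.includeRight : B i →ₐ[A] A' ⊗[A] B i).restrictScalars k),
    fun i => ?_, fun i D u v huv => ?_, fun a a' h => eq_of_faithfullyFlat_pi (fun i => B i) h,
    fun c hc => exists_of_faithfullyFlat_pi (fun i => B i) c fun i j => ?_⟩
  · ext a
    exact Algebra.TensorProduct.tmul_one_eq_one_tmul (R := A) a
  · let _ : Algebra A D := (f ≫ u).hom.toRingHom.toAlgebra
    have : IsScalarTower k A D := .of_algebraMap_eq fun r => ((f ≫ u).hom.commutes r).symm
    let u' : A' →ₐ[A] D := { u.hom.toRingHom with commutes' := fun a => rfl }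
    let v' : B i →ₐ[A] D := { v.hom.toRingHom with
      commutes' := fun a => (congrArg (fun φ => φ a) huv).symm }
    refine ⟨CommAlgCat.ofHom ((Algebra.TensorProduct.productMap u' v').restrictScalars k), ?_⟩
    ext a
    exact Algebra.TensorProduct.productMap_left_apply u' v' a
  -- It suffices to use the compatibility in the universal case `D = C i ⊗[A'] C j`.
  · refine hc i j (CommAlgCat.of k ((A' ⊗[A] B i) ⊗[A'] (A' ⊗[A] B j)))
      (CommAlgCat.ofHom ((Algebra.TensorProduct.includeLeft :
        A' ⊗[A] B i →ₐ[A'] (A' ⊗[A] B i) ⊗[A'] (A' ⊗[A] B j)).restrictScalars k))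
      (CommAlgCat.ofHom ((Algebra.TensorProduct.includeRight :
        A' ⊗[A] B j →ₐ[A'] (A' ⊗[A] B i) ⊗[A'] (A' ⊗[A] B j)).restrictScalars k)) ?_
    ext a
    exact Algebra.TensorProduct.tmul_one_eq_one_tmul (R := A') a

/-- For the generated topology it is enough to test pullbacks of covering sieves along arbitrary
`f`. Such a pullback is generated by the base-changed family `C i = A' ⊗[A] B i`, to which descent
of elements applies. -/
lemma isSheaf_structurePresheaf : Presheaf.IsSheaf (fpqc k) (structurePresheaf k) := by
  rw [isSheaf_iff_isSheaf_of_type]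
  refine (Precoverage.isSheaf_toGrothendieck_iff (structurePresheaf k)).2 ?_
  rintro X Y f R ⟨n, B, b, hb, rfl⟩ x hx
  obtain ⟨C, g, h, hgh, hlift, hinj, hdesc⟩ := exists_baseChange f.unop B b hb
  have hmem : ∀ i, ((Sieve.generate (Presieve.ofArrows (fun i => op (B i))
      fun i => (b i).op)).pullback f).arrows (g i).op := fun i =>
    ⟨_, (h i).op, _, ⟨i⟩, congrArg Quiver.Hom.op (hgh i).symm⟩
  obtain ⟨a, ha⟩ := hdesc (fun i => (x _ (hmem i)).down) fun i j D u v huv =>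
    congrArg ULift.down (hx u.op v.op (hmem i) (hmem j) (congrArg Quiver.Hom.op huv))
  refine ⟨ULift.up a, ?_, ?_⟩
  · rintro Z p hp
    obtain ⟨_, q, _, ⟨i⟩, hq⟩ := id hp
    obtain ⟨l, hl⟩ := hlift i Z.unop p.unop q.unop (congrArg Quiver.Hom.unop hq.symm)
    have h1 := hx l.op (𝟙 Z) (hmem i) hp (by
      rw [Category.id_comp]; exact congrArg Quiver.Hom.op hl)
    have h2 : l (x _ (hmem i)).down = (x p hp).down := congrArg ULift.down h1
    refine ULift.ext _ _ ?_
    rw [← h2, ← ha i]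
    exact (congrArg (fun φ => φ a) hl).symm
  · rintro ⟨a'⟩ ha'
    refine ULift.ext _ _ (hinj _ _ fun i => ?_)
    rw [ha i]
    exact congrArg ULift.down (ha' _ (hmem i))

end Descent

/-! ### Profinite sets and their algebras of locally constant functions -/

section LocallyConstantAlgebra

variable (k : Type u) [Field k]

/-- The algebra of locally constant functions on a profinite set. -/
abbrev locConst (S : Profinite.{u}) : CommAlgCat.{u} k := CommAlgCat.of k (LocallyConstant S k)

/-- Evaluation at the points of `S`, as a map to the Stone dual of the algebra of locally constant
functions on `S`. -/
def evalPoint (S : Profinite.{u}) : S ⟶ (stoneDual k).obj (op (locConst k S)) :=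
  CompHausLike.ofHom _
    { toFun := fun s => AlgHom.comp (LocallyConstant.evalₐ k s) (pearl k (locConst k S)).val
      continuous_toFun := by
        let _ : TopologicalSpace k := ⊥
        have : DiscreteTopology k := ⟨rfl⟩
        refine continuous_induced_rng.2 (continuous_pi fun a => ?_)
        exact (IsLocallyConstant.iff_continuous _).1 (LocallyConstant.isLocallyConstant a.1) }

variable {k}

lemma eval_evalPoint {S : Profinite.{u}} (a : pearl k (locConst k S)) (s : S) :
    PearlPoints.eval _ a (evalPoint k S s) = (a : LocallyConstant S k) s := rfl

/-- Clopen sets separate points, and their characteristic functions are idempotent, hence in the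
pearl. -/
lemma evalPoint_injective (S : Profinite.{u}) : Function.Injective (evalPoint k S) := by
  intro s t h
  by_contra hst
  obtain ⟨U, hU, hs, ht⟩ := exists_isClopen_of_totally_separated hst
  have he : IsIdempotentElem (LocallyConstant.charFn k hU : locConst k S) := by
    ext x
    by_cases hx : x ∈ U <;> simp [LocallyConstant.coe_charFn, hx]
  have h' := congrArg (PearlPoints.eval _ ⟨_, idem_mem_pearl (locConst k S) he⟩) h
  rw [eval_evalPoint, eval_evalPoint] at h'
  simp only [LocallyConstant.coe_charFn, Set.indicator_of_mem hs] at h'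
  rw [Set.indicator_of_notMem ht] at h'
  exact one_ne_zero h'

/-- The image is compact. A missed `χ` would give `e` in the pearl with value `1` at `χ` and
vanishing on the image; but then `e` is zero as a function on `S`. -/
lemma evalPoint_surjective (S : Profinite.{u}) : Function.Surjective (evalPoint k S) := by
  intro χ
  by_contra hχ
  have hcomp : IsCompact (Set.range (evalPoint k S)) :=
    isCompact_range (evalPoint k S).hom.hom.continuous
  obtain ⟨e, h1, h0⟩ := PearlPoints.exists_eval_eq_one_of_isCompact hcomp hχ
  have : e = 0 := Subtype.ext (LocallyConstant.ext fun s => h0 _ ⟨s, rfl⟩)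
  rw [this] at h1
  exact zero_ne_one ((map_zero (PearlPoints.toAlgHom χ)).symm.trans h1)

variable (k) in
/-- A profinite set is the Stone dual of its algebra of locally constant functions. -/
def evalIso (S : Profinite.{u}) : S ≅ (stoneDual k).obj (op (locConst k S)) :=
  CompHausLike.isoOfBijective (evalPoint k S) ⟨evalPoint_injective S, evalPoint_surjective S⟩

lemma evalIso_hom (S : Profinite.{u}) : (evalIso k S).hom = evalPoint k S := rfl

/-- Pullback of locally constant functions. -/
def locConstMap {S T : Profinite.{u}} (p : S ⟶ T) : locConst k T ⟶ locConst k S :=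
  CommAlgCat.ofHom (LocallyConstant.comapₐ k p.hom.hom)

lemma evalPoint_naturality {S T : Profinite.{u}} (p : S ⟶ T) :
    p ≫ evalPoint k T = evalPoint k S ≫ (stoneDual k).map (locConstMap p).op := rfl

lemma evalIso_inv_naturality {S T : Profinite.{u}} (p : S ⟶ T) :
    (evalIso k S).inv ≫ p = (stoneDual k).map (locConstMap p).op ≫ (evalIso k T).inv := by
  rw [Iso.inv_comp_eq, ← Category.assoc, Iso.eq_comp_inv]
  exact evalPoint_naturality p

variable (k) in
/-- Stone duality, as a homomorphism from the algebra of locally constant functions on the Stone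
dual of `A` to `A`. -/
def dualHom (A : CommAlgCat.{u} k) : locConst k ((stoneDual k).obj (op A)) ⟶ A :=
  CommAlgCat.ofHom ((pearl k A).val.comp (AlgHom.ofLinearMap (R := k)
    { toFun := fun f => (PearlPoints.exists_eval_eq f.isLocallyConstant).choose
      -- The chosen preimage is unique because values at `k`-points determine elements of the pearl;
      -- compatibility with each operation is checked at points.
      map_add' := fun f g => pearl_ext A fun χ => by
        have h := fun f : LocallyConstant ((stoneDual k).obj (op A)) k =>
          (PearlPoints.exists_eval_eq (A := A) f.isLocallyConstant).choose_spec χ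
        exact (h _).trans ((congrArg₂ (· + ·) (h f) (h g)).symm.trans (map_add χ _ _).symm)
      map_smul' := fun c f => pearl_ext A fun χ => by
        have h := fun f : LocallyConstant ((stoneDual k).obj (op A)) k =>
          (PearlPoints.exists_eval_eq (A := A) f.isLocallyConstant).choose_spec χ
        exact (h _).trans ((congrArg (c * ·) (h f)).symm.trans (map_smul χ c _).symm) }
    (pearl_ext A fun χ => ((PearlPoints.exists_eval_eq (A := A)
      (1 : LocallyConstant ((stoneDual k).obj (op A)) k).isLocallyConstant).choose_spec χ).trans
        (map_one χ).symm)
    (fun f g => pearl_ext A fun χ => by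
        have h := fun f : LocallyConstant ((stoneDual k).obj (op A)) k =>
          (PearlPoints.exists_eval_eq (A := A) f.isLocallyConstant).choose_spec χ
        exact (h _).trans ((congrArg₂ (· * ·) (h f) (h g)).symm.trans (map_mul χ _ _).symm))))

lemma exists_dualHom_eq (A : CommAlgCat.{u} k)
    (f : LocallyConstant ((stoneDual k).obj (op A)) k) :
    ∃ a : pearl k A, (a : A) = dualHom k A f ∧
      ∀ χ : PearlPoints k A, PearlPoints.eval A a χ = f χ :=
  ⟨_, rfl, (PearlPoints.exists_eval_eq f.isLocallyConstant).choose_spec⟩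

lemma dualHom_eq_iff {A : CommAlgCat.{u} k} {f : LocallyConstant ((stoneDual k).obj (op A)) k}
    {a : pearl k A} : dualHom k A f = a ↔ ∀ χ : PearlPoints k A, PearlPoints.eval A a χ = f χ := by
  obtain ⟨b, hb, hb'⟩ := exists_dualHom_eq A f
  rw [← hb]
  constructor
  · intro h
    rwa [← Subtype.ext h]
  · intro h
    exact congrArg Subtype.val (pearl_ext A fun χ => (hb' χ).trans (h χ).symm)

/-- A triangle identity of Stone duality, up to inverting `evalIso`: composing `χ` with `dualHom` is
evaluation at `χ`. -/
lemma map_dualHom (A : CommAlgCat.{u} k) :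
    (stoneDual k).map (dualHom k A).op = evalPoint k ((stoneDual k).obj (op A)) := by
  ext χ
  refine AlgHom.ext fun a => ?_
  exact (dualHom_eq_iff (f := a.1) (a := pearlMap (dualHom k A).hom a)).1 rfl χ

lemma dualHom_naturality {A B : CommAlgCat.{u} k} (f : A ⟶ B) :
    locConstMap ((stoneDual k).map f.op) ≫ dualHom k B = dualHom k A ≫ f := by
  ext g
  obtain ⟨a, ha, ha'⟩ := exists_dualHom_eq A g
  change dualHom k B (locConstMap ((stoneDual k).map f.op) g) = f (dualHom k A g)
  rw [← ha]
  exact (dualHom_eq_iff (a := pearlMap f.hom a)).2 fun χ => ha' ((stoneDual k).map f.op χ)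

end LocallyConstantAlgebra

/-! ### Comparison of global functions with functions on `X` -/

section Main

variable {k : Type u} [Field k] {X : CondSet.{u}}

lemma mapPoints_petraPoint {A B : CommAlgCat.{u} k} (f : A ⟶ B)
    (y : X.obj.obj (op ((stoneDual k).obj (op A)))) :
    ((petra k).obj X).mapPoints f (petraPoint X A y) =
      petraPoint X B (X.obj.map ((stoneDual k).map f.op).op y) :=
  (NatTrans.naturality_apply (toSheafify (fpqc k) ((stoneDual k).op ⋙ X.obj)) f.op.op y).symm

variable (k X) in
/-- The functions on a condensed set defined by a global function on its petra space. -/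
def toCondFunctions : globalSections ((petra k).obj X) →ₐ[k] condFunctions k X where
  toFun φ := ⟨fun S x s => (show LocallyConstant S k from φ.1 (locConst k S)
      (petraPoint X (locConst k S) (X.obj.map (evalIso k S).inv.op x))) s,
    fun S x => LocallyConstant.isLocallyConstant _, fun S T p x s => by
      have h : X.obj.map (evalIso k S).inv.op (X.obj.map p.op x) =
          X.obj.map ((stoneDual k).map (locConstMap p).op).op
            (X.obj.map (evalIso k T).inv.op x) := by
        rw [← Functor.map_comp_apply, ← Functor.map_comp_apply, ← op_comp, ← op_comp,
          evalIso_inv_naturality]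
      beta_reduce
      rw [h, ← mapPoints_petraPoint, φ.2]
      rfl⟩
  map_one' := rfl
  map_mul' _ _ := rfl
  map_zero' := rfl
  map_add' _ _ := rfl
  commutes' _ := rfl

/-- The locally constant function on `S` which a natural family attaches to `x ∈ X(S)`. -/
def toLocallyConstant (F : condFunctions k X) {S : Profinite.{u}}
    (x : X.obj.obj (op S)) : LocallyConstant S k :=
  ⟨F.1 S x, F.2.1 S x⟩

lemma toCondFunctions_toLocallyConstant (φ : globalSections ((petra k).obj X))
    {S : Profinite.{u}} (x : X.obj.obj (op S)) :
    toLocallyConstant (toCondFunctions k X φ) x = φ.1 (locConst k S)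
      (petraPoint X (locConst k S) (X.obj.map (evalIso k S).inv.op x)) := rfl

lemma toLocallyConstant_map (F : condFunctions k X) {S T : Profinite.{u}}
    (p : S ⟶ T) (x : X.obj.obj (op T)) :
    toLocallyConstant F (X.obj.map p.op x) = locConstMap p (toLocallyConstant F x) :=
  LocallyConstant.ext fun s => F.2.2 S T p x s

/-- The point `[y]` is the image under `dualHom k A` of the point over `locConst k` of the Stone
dual at which the function attached to `φ` was defined; `map_dualHom` makes the two identifications
agree. -/
lemma apply_petraPoint (φ : globalSections ((petra k).obj X)) (A : CommAlgCat.{u} k)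
    (y : X.obj.obj (op ((stoneDual k).obj (op A)))) :
    φ.1 A (petraPoint X A y) = dualHom k A (toLocallyConstant (toCondFunctions k X φ) y) := by
  rw [toCondFunctions_toLocallyConstant, ← φ.2, mapPoints_petraPoint, map_dualHom,
    ← Functor.map_comp_apply, ← op_comp, ← evalIso_hom, Iso.hom_inv_id, op_id,
    Functor.map_id_apply]

/-- A global function, as a map to the structure sheaf. -/
def globalSections.toHom {𝒳 : FpqcSheaf k} (φ : globalSections 𝒳) :
    𝒳.obj ⟶ structurePresheaf k where
  app A := ↾fun x => ULift.up (φ.1 A.unop.unop x)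
  naturality A B f := by
    ext x
    exact ULift.ext _ _ (φ.2 _ _ f.unop.unop x)

/-- The structure presheaf is a sheaf, so maps to it from a sheafification are determined on the
original presheaf. -/
lemma globalSections_ext {φ ψ : globalSections ((petra k).obj X)}
    (h : ∀ A y, φ.1 A (petraPoint X A y) = ψ.1 A (petraPoint X A y)) : φ = ψ := by
  have : globalSections.toHom φ = globalSections.toHom ψ :=
    sheafify_hom_ext (fpqc k) _ _ isSheaf_structurePresheaf (by
      ext A y
      exact ULift.ext _ _ (h A.unop.unop y))
  refine Subtype.ext (funext fun A => funext fun x => ?_)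
  exact congrArg (fun η : ((petra k).obj X).obj ⟶ structurePresheaf k =>
    (η.app (op (op A)) x).down) this

lemma toCondFunctions_injective : Function.Injective (toCondFunctions k X) := fun φ ψ h =>
  globalSections_ext fun A y => by rw [apply_petraPoint, apply_petraPoint, h]

/-- The map from the presheaf `A ↦ X(Hom(pearl A, k))` to the structure sheaf defined by a function
on `X`. -/
def homOfCondFunction (F : condFunctions k X) :
    (stoneDual k).op ⋙ X.obj ⟶ structurePresheaf k where
  app A := ↾fun y => ULift.up (dualHom k A.unop.unop (toLocallyConstant F y))
  naturality A B f := by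
    ext y
    refine ULift.ext _ _ ?_
    change dualHom k B.unop.unop (toLocallyConstant F
      (X.obj.map ((stoneDual k).map f.unop.unop.op).op y)) =
        f.unop.unop (dualHom k A.unop.unop (toLocallyConstant F y))
    rw [toLocallyConstant_map F]
    exact congrArg (fun η => η (toLocallyConstant F y)) (dualHom_naturality f.unop.unop)

/-- The global function on the petra space defined by a function on `X`. -/
def globalSectionOfCondFunction (F : condFunctions k X) : globalSections ((petra k).obj X) :=
  let η : ((petra k).obj X).obj ⟶ structurePresheaf k :=
    sheafifyLift (fpqc k) (homOfCondFunction F) isSheaf_structurePresheaf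
  ⟨fun A x => (η.app (op (op A)) x).down,
    fun _ _ f x => congrArg ULift.down (NatTrans.naturality_apply η f.op.op x)⟩

lemma globalSectionOfCondFunction_apply (F : condFunctions k X) (A : CommAlgCat.{u} k)
    (y : X.obj.obj (op ((stoneDual k).obj (op A)))) :
    (globalSectionOfCondFunction F).1 A (petraPoint X A y) = dualHom k A (toLocallyConstant F y) :=
  congrArg (fun η : (stoneDual k).op ⋙ X.obj ⟶ structurePresheaf k =>
    (η.app (op (op A)) y).down) (toSheafify_sheafifyLift (fpqc k) (homOfCondFunction F) isSheaf_structurePresheaf)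

/-- Both sides have the same value at each `s`, read off at the point `evalPoint k S s` of the Stone
dual. This shows that the two constructions are inverse on functions. -/
lemma dualHom_locConst {S : Profinite.{u}} (f : LocallyConstant S k) :
    dualHom k (locConst k S) (locConstMap (evalIso k S).inv f) = f := by
  obtain ⟨a, ha, ha'⟩ := exists_dualHom_eq (locConst k S) (locConstMap (evalIso k S).inv f)
  rw [← ha]
  refine LocallyConstant.ext fun s => (ha' (evalPoint k S s)).trans ?_
  change f ((evalIso k S).inv ((evalIso k S).hom s)) = f s
  rw [Iso.hom_inv_id_apply]

lemma toCondFunctions_surjective : Function.Surjective (toCondFunctions k X) := by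
  intro F
  refine ⟨globalSectionOfCondFunction F, Subtype.ext (funext fun S => funext fun x => ?_)⟩
  have : toLocallyConstant (toCondFunctions k X (globalSectionOfCondFunction F)) x = toLocallyConstant F x := by
    rw [toCondFunctions_toLocallyConstant, globalSectionOfCondFunction_apply F, toLocallyConstant_map F,
      dualHom_locConst]
  exact congrArg (fun f : LocallyConstant S k => (f : S → k)) this

variable (k X) in
/-- Global functions on the petra space are functions on the condensed set. -/
def globalSectionsEquiv : globalSections ((petra k).obj X) ≃ₐ[k] (X ⟶ discreteCond k) :=
  (AlgEquiv.ofBijective (toCondFunctions k X)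
    ⟨toCondFunctions_injective, toCondFunctions_surjective⟩).trans
    (condHomEquiv.algEquiv k).symm

end Main

end

end Petra

theorem mainTheorem7 {k : Type u} [Field k] (X : Petra.CondSet.{u}) :
    ∃ e : Petra.globalSections ((Petra.petra k).obj X) ≃ₐ[k] (X ⟶ Petra.discreteCond k),
      ∀ (φ : Petra.globalSections ((Petra.petra k).obj X)) (A : CommAlgCat.{u} k)
        (y : X.obj.obj (op ((Petra.stoneDual k).obj (op A)))),
        ∃ a : Petra.pearl k A, (a : A) = φ.1 A (Petra.petraPoint X A y) ∧
          ∀ χ : Petra.pearl k A →ₐ[k] k,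
            χ a = Petra.discreteCond.eval
              ((e φ).hom.app (op ((Petra.stoneDual k).obj (op A))) y) χ := by
  refine ⟨Petra.globalSectionsEquiv k X, fun φ A y => ?_⟩
  obtain ⟨a, ha, ha'⟩ := Petra.exists_dualHom_eq A
    (Petra.toLocallyConstant (Petra.toCondFunctions k X φ) y)
  -- The section attached to `y` unfolds to `toLocallyConstant (toCondFunctions k X φ) y`, so `ha'`
  -- is already the evaluation formula.
  exact ⟨a, ha.trans (Petra.apply_petraPoint φ A y).symm, ha'⟩
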